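/- Let $\mathbb X$ be a Borel subset of a complete separable metric space, with metric written $\|x-x'\|$, let $\mathbb U$ be a finite nonempty action set, let $\mathcal T(\cdot\mid x,u)$ be a stochastic kernel from $\mathbb X\times\mathbb U$ to $\mathbb X$, let $c:\mathbb X\times\mathbb U\to\mathbb R$ be a bounded stage cost, $\|c\|_\infty=\sup_{x,u}|c(x,u)|$, and let $0<\beta<1$. An admissible policy $\gamma=(\gamma_t)_{t\ge 0}\in\Gamma$ is a sequence of measurable maps giving $U_t=\gamma_t(X_0,\dots,X_t,U_0,\dots,U_{t-1})$; together with $X_0=x_0$ and $X_{t+1}\sim\mathcal T(\cdot\mid X_t,U_t)$ it determines the law of $(X_t,U_t)_{t\ge0}$, with expectation $E^{\gamma}_{x_0}$. Put $$J^*_\beta(x_0)=\inf_{\gamma\in\Gamma}E^{\gamma}_{x_0}\Big[\sum_{t=0}^\infty\beta^t c(X_t,U_t)\Big].$$ Let $B_1,\dots,B_M$ be a partition of $\mathbb X$ into Borel sets (bins) with representatives $y_i\in B_i$, let $\mathbb Y=\{y_1,\dots,y_M\}$, and let $\pi^*$ be a probability measure on $\mathbb X$ with $\pi^*(B_i)>0$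 for all $i$; put $\hat\pi^*_{y_i}(A)=\pi^*(A\cap B_i)/\pi^*(B_i)$. Let $\hat J_\beta:\mathbb Y\to\mathbb R$ be the optimal value function, for discount factor $\beta$, of the finite model with state space $\mathbb Y$, action set $\mathbb U$, and $$C^*(y_i,u)=\int_{B_i}c(x,u)\,\hat\pi^*_{y_i}(dx),\qquad P^*(y_j\mid y_i,u)=\int_{B_i}\mathcal T(B_j\mid x,u)\,\hat\pi^*_{y_i}(dx),$$ extended to $\mathbb X$ by $\hat J_\beta(x)=\hat J_\beta(y_i)$ for $x\in B_i$. For $x\in B_i$ let $$L(x)=\int_{B_i}\|x-x'\|\,\hat\pi^*_{y_i}(dx')\in[0,\infty].$$ Suppose that there are constants $\alpha_c,\alpha_T>0$ such that, for all $x,x'\in\mathbb X$ and $u\in\mathbb U$, $$|c(x,u)-c(x',u)|\le\alpha_c\|x-x'\|,\qquad \|\mathcal T(\cdot\mid x,u)-\mathcal T(\cdot\mid x',u)\|_{TV}\le\alpha_T\|x-x'\|,$$ where $\|\mu-\nu\|_{TV}=2\sup_{B\text{ Borel}}|\mu(B)-\nu(B)|$. Then for every initial state $x_0\in\mathbb X$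 $$\big|\hat J_\beta(x_0)-J^*_\beta(x_0)\big|\le\Big(\alpha_c+\frac{\beta\,\alpha_T\,\|c\|_\infty}{1-\beta}\Big)\sum_{t=0}^\infty\beta^t\sup_{\gamma\in\Gamma}E^{\gamma}_{x_0}\big[L(X_t)\big],$$ where the right-hand side may be $+\infty$. -/

import Mathlib

open MeasureTheory ProbabilityTheory
open scoped ENNReal

/-- An admissible (deterministic, history dependent) policy. At time `t` the action is a measurable
function of the past state-action pairs `(X_0, U_0), …, (X_{t-1}, U_{t-1})` and of the current
state `X_t`. -/
structure Policy (X U : Type*) [MeasurableSpace X] [MeasurableSpace U] where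
  act : (t : ℕ) → (Fin t → X × U) × X → U
  measurable_act : ∀ t, Measurable (act t)

section MDP

variable {X U : Type*} [MeasurableSpace X] [MeasurableSpace U]

/-- The trajectory up to time `t`, listed with indices `0, …, t`. -/
def pastList (t : ℕ) (h : (i : Finset.Iic t) → X × U) : Fin (t + 1) → X × U :=
  fun i => h ⟨i, Finset.mem_Iic.2 (Nat.lt_succ_iff.1 i.2)⟩

theorem measurable_pastList (t : ℕ) : Measurable (pastList (X := X) (U := U) t) :=
  measurable_pi_lambda _ fun _ => measurable_pi_apply _

/-- One step of the controlled chain: given `(X_0, U_0), …, (X_t, U_t)`, draw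
`X_{t+1} ∼ T(· | X_t, U_t)` and apply `U_{t+1} = γ_{t+1}(X_0, U_0, …, X_t, U_t, X_{t+1})`. -/
noncomputable def stepKernel (T : Kernel (X × U) X) (γ : Policy X U) (t : ℕ) :
    Kernel ((i : Finset.Iic t) → X × U) (X × U) :=
  (T.comap (fun h : (i : Finset.Iic t) → X × U => h ⟨t, Finset.mem_Iic.2 le_rfl⟩)
      (measurable_pi_apply _)) ⊗ₖ
    Kernel.deterministic
      (fun p : ((i : Finset.Iic t) → X × U) × X => γ.act (t + 1) (pastList t p.1, p.2))
      ((γ.measurable_act (t + 1)).comp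
        (((measurable_pastList t).comp measurable_fst).prodMk measurable_snd))

instance (T : Kernel (X × U) X) [IsMarkovKernel T] (γ : Policy X U) (t : ℕ) :
    IsMarkovKernel (stepKernel T γ t) := by
  unfold stepKernel; infer_instance

/-- The law of the state-action process `((X_t, U_t))_t` started from `X_0 = x₀`, under the
transition kernel `T` and the policy `γ`. -/
noncomputable def processLaw (T : Kernel (X × U) X) [IsMarkovKernel T] (γ : Policy X U) (x₀ : X) :
    Measure (ℕ → X × U) :=
  Kernel.traj (X := fun _ => X × U) (stepKernel T γ) 0
    (fun _ => (x₀, γ.act 0 (Fin.elim0, x₀)))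

/-- The discounted expected cost `J_β(x₀, γ)`. -/
noncomputable def discountedCost (T : Kernel (X × U) X) [IsMarkovKernel T] (c : X → U → ℝ) (β : ℝ)
    (x₀ : X) (γ : Policy X U) : ℝ :=
  ∫ ω, ∑' t : ℕ, β ^ t * c (ω t).1 (ω t).2 ∂(processLaw T γ x₀)

/-- The optimal value function `J*_β(x₀)`. -/
noncomputable def optimalValue (T : Kernel (X × U) X) [IsMarkovKernel T] (c : X → U → ℝ) (β : ℝ)
    (x₀ : X) : ℝ :=
  ⨅ γ : Policy X U, discountedCost T c β x₀ γ

end MDP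

/-- The total variation distance, normalised as `2 sup_B |μ(B) - ν(B)|`. -/
noncomputable def tvDist {X : Type*} [MeasurableSpace X] (μ ν : Measure X) : ℝ :=
  2 * ⨆ B : {B : Set X // MeasurableSet B}, |μ.real B - ν.real B|

/-- The supremum norm of a cost function. -/
noncomputable def costSupNorm {X U : Type*} (c : X → U → ℝ) : ℝ :=
  ⨆ p : X × U, |c p.1 p.2|

/-- A finite quantization of `X`: a finite set `Y ⊆ X` of representatives, the quantization map
`q : X → Y` (whose fibres are the bins, each one containing its representative), and a weighting
probability measure which charges every bin. -/
structure Quantization (X : Type*) [MeasurableSpace X] where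
  Y : Finset X
  q : X → Y
  measurableSet_bin : ∀ y, MeasurableSet (q ⁻¹' {y})
  q_rep : ∀ y : Y, q y = y
  weight : Measure X
  isProbabilityMeasure_weight : IsProbabilityMeasure weight
  weight_pos : ∀ y, 0 < weight (q ⁻¹' {y})

namespace Quantization

variable {X U : Type*} [MeasurableSpace X] [MeasurableSpace U]

/-- The bin of the representative `y`. -/
def bin (Q : Quantization X) (y : Q.Y) : Set X := Q.q ⁻¹' {y}

/-- The normalised weighting measure of a bin, `A ↦ π(A ∩ B) / π(B)`; it is carried by the bin. -/
noncomputable def normWeight (Q : Quantization X) (y : Q.Y) : Measure X :=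
  ProbabilityTheory.cond Q.weight (Q.bin y)

instance (Q : Quantization X) (y : Q.Y) : IsProbabilityMeasure (Q.normWeight y) := by
  have := Q.isProbabilityMeasure_weight
  exact cond_isProbabilityMeasure (Q.weight_pos y).ne'

/-- The stage cost of the finite model. -/
noncomputable def finiteCost (Q : Quantization X) (c : X → U → ℝ) (y : Q.Y) (u : U) : ℝ :=
  ∫ x, c x u ∂(Q.normWeight y)

/-- The transition probability `P(z | y, u)` of the finite model. -/
noncomputable def transProb (Q : Quantization X) (T : Kernel (X × U) X) (y : Q.Y) (u : U)
    (z : Q.Y) : ℝ≥0∞ :=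
  ∫⁻ x, T (x, u) (Q.bin z) ∂(Q.normWeight y)

/-- The transition kernel of the finite model. -/
noncomputable def finiteKernel [MeasurableSingletonClass X] [Countable U]
    [MeasurableSingletonClass U] (Q : Quantization X) (T : Kernel (X × U) X) :
    Kernel (Q.Y × U) Q.Y where
  toFun p := ∑ z : Q.Y, Q.transProb T p.1 p.2 z • Measure.dirac z
  measurable' := measurable_of_countable _

theorem sum_transProb (Q : Quantization X) (T : Kernel (X × U) X) [IsMarkovKernel T] (y : Q.Y)
    (u : U) : ∑ z : Q.Y, Q.transProb T y u z = 1 := by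
  have hm : ∀ z : Q.Y, Measurable fun x => T (x, u) (Q.bin z) := fun z =>
    (Kernel.measurable_coe T (Q.measurableSet_bin z)).comp measurable_prodMk_right
  have hs : ∀ x, ∑ z : Q.Y, T (x, u) (Q.bin z) = 1 := by
    intro x
    have hU : (⋃ z ∈ (Finset.univ : Finset Q.Y), Q.bin z) = Set.univ := by
      ext x; simp [bin]
    have hd : ((Finset.univ : Finset Q.Y) : Set Q.Y).PairwiseDisjoint Q.bin :=
      fun a _ b _ hab => Disjoint.preimage _ (Set.disjoint_singleton.2 hab)
    rw [← measure_biUnion_finset hd (fun z _ => Q.measurableSet_bin z), hU]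
    exact measure_univ
  simp only [transProb]
  rw [← lintegral_finsetSum _ (fun z _ => hm z), lintegral_congr hs]
  simp

instance [MeasurableSingletonClass X] [Countable U] [MeasurableSingletonClass U]
    (Q : Quantization X) (T : Kernel (X × U) X) [IsMarkovKernel T] :
    IsMarkovKernel (Q.finiteKernel T) := by
  refine ⟨fun p => ⟨?_⟩⟩
  change (∑ z : Q.Y, Q.transProb T p.1 p.2 z • Measure.dirac z) Set.univ = 1
  simpa using Q.sum_transProb T p.1 p.2

/-- The optimal value function of the finite model, extended to `X` as a constant on every bin. -/
noncomputable def extendedValue [MeasurableSingletonClass X] [Countable U]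
    [MeasurableSingletonClass U] (Q : Quantization X) (T : Kernel (X × U) X) [IsMarkovKernel T]
    (c : X → U → ℝ) (β : ℝ) (x : X) : ℝ :=
  optimalValue (Q.finiteKernel T) (Q.finiteCost c) β (Q.q x)

/-- The average loss `L(x)`: the mean distance from `x` to the points of its own bin under the
normalised weighting measure, as an element of `[0, ∞]`. -/
noncomputable def loss {X : Type*} [MetricSpace X] [MeasurableSpace X] (Q : Quantization X)
    (x : X) : ℝ≥0∞ :=
  ∫⁻ x', edist x x' ∂(Q.normWeight (Q.q x))

end Quantization

/-!
The value function of the finite model is compared with the original model by verification rather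
than by solving the Bellman equation of the original model, so that no optimal policy for the
original model is needed.

For a bounded measurable function `V`, call
`V(x) - (c(x, u) + β ∫ V dT(· | x, u))` its Bellman residual at `(x, u)`. The Markov property makes
the terms `β^t E[V(X_t)]` telescope, which gives the performance identity
`hasSum_bellmanResidual`: under every policy, `V(x₀) - J_β(x₀, γ)` is the discounted sum of the
expected residuals along the trajectory. Hence a bound of the residual from above, at all
state-action pairs, bounds `V - J*` from above (`ofReal_sub_optimalValue_le`), and a bound from
below along the actions of one stationary policy bounds `V - J*` from below
(`ofReal_optimalValue_sub_le`).

In a finite-state model, a fixed point of the Bellman operator has nonpositive residual, and zero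
residual along a greedy policy, so the two bounds identify it with the optimal value function
(`bellmanResidual_optimalValue`). Let now `V` be the optimal value function of the quantized model
and `q` the quantization map. Since the quantized model averages the original one over each bin,
the residual of `V ∘ q` at `(x, u)` in the original model is the residual of `V` at `(q x, u)` in
the finite model plus the deviation of `c(·, u) + β ∫ V ∘ q dT(· | ·, u)` at `x` from its average
over the bin of `x` (`Quantization.bellmanResidual_comp_q`). Since `|V| ≤ ‖c‖ / (1 - β)`, this
function is Lipschitz with constant `α_c + β α_T ‖c‖ / (1 - β)`, so the deviation is at most this
constant times `L(x)`. The two bounds above, applied to `V ∘ q`, give the two sides of the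
estimate; the second one uses the policy that is greedy for the finite model.
-/

/-! ### The law of the controlled process -/

section ProcessLaw

variable {X U : Type*} [MeasurableSpace X] [MeasurableSpace U]

instance (T : Kernel (X × U) X) [IsMarkovKernel T] (γ : Policy X U) (x₀ : X) :
    IsProbabilityMeasure (processLaw T γ x₀) := by
  unfold processLaw; infer_instance

theorem map_fst_stepKernel (T : Kernel (X × U) X) [IsMarkovKernel T] (γ : Policy X U) (t : ℕ)
    (h : (i : Finset.Iic t) → X × U) :
    (stepKernel T γ t h).map Prod.fst = T (h ⟨t, Finset.mem_Iic.2 le_rfl⟩) := by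
  rw [← Kernel.fst_apply, stepKernel, Kernel.fst_compProd, Kernel.comap_apply]

/-- The joint law of the trajectory up to time `t` and of the state-action pair at time `t + 1`. -/
theorem map_processLaw_step (T : Kernel (X × U) X) [IsMarkovKernel T] (γ : Policy X U) (x₀ : X)
    (t : ℕ) :
    (processLaw T γ x₀).map (fun ω => (Preorder.frestrictLe (π := fun _ => X × U) t ω, ω (t + 1)))
      = (processLaw T γ x₀).map (Preorder.frestrictLe (π := fun _ => X × U) t)
          ⊗ₘ stepKernel T γ t := by
  unfold processLaw
  rw [← Kernel.partialTraj_compProd_eq_map_traj (Nat.zero_le t),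
    Kernel.traj_map_frestrictLe_apply]

theorem map_processLaw_zero (T : Kernel (X × U) X) [IsMarkovKernel T] (γ : Policy X U) (x₀ : X) :
    (processLaw T γ x₀).map (fun ω => ω 0) = Measure.dirac (x₀, γ.act 0 (Fin.elim0, x₀)) := by
  have h : (fun ω : ℕ → X × U => ω 0) =
      (fun h : (i : Finset.Iic 0) → X × U => h ⟨0, Finset.mem_Iic.2 le_rfl⟩) ∘
        Preorder.frestrictLe (π := fun _ => X × U) 0 := rfl
  rw [h, ← Measure.map_map (by fun_prop) (by fun_prop), processLaw,
    Kernel.traj_map_frestrictLe_apply, Kernel.partialTraj_self, Kernel.id_apply]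
  exact Measure.map_dirac' (measurable_pi_apply _) _

/-- The Markov property, integrated: `E[f(X_{t+1})] = E[∫ f dT(· | X_t, U_t)]`. -/
theorem integral_processLaw_succ (T : Kernel (X × U) X) [IsMarkovKernel T] (γ : Policy X U)
    (x₀ : X) {f : X → ℝ} (hf : Measurable f) {K : ℝ} (hK : ∀ x, |f x| ≤ K) (t : ℕ) :
    ∫ ω, f (ω (t + 1)).1 ∂(processLaw T γ x₀) =
      ∫ ω, ∫ x, f x ∂(T (ω t)) ∂(processLaw T γ x₀) := by
  have hm : Measurable (Preorder.frestrictLe (π := fun _ : ℕ => X × U) t) := by fun_prop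
  have hint : Integrable
      (fun p : ((i : Finset.Iic t) → X × U) × (X × U) => f p.2.1)
      ((processLaw T γ x₀).map (Preorder.frestrictLe (π := fun _ => X × U) t)
        ⊗ₘ stepKernel T γ t) := by
    have := Measure.isProbabilityMeasure_map (μ := processLaw T γ x₀) hm.aemeasurable
    exact Integrable.of_bound (hf.comp (measurable_fst.comp measurable_snd)).aestronglyMeasurable K
      (ae_of_all _ fun p => hK _)
  calc ∫ ω, f (ω (t + 1)).1 ∂(processLaw T γ x₀)
      = ∫ p, f p.2.1 ∂((processLaw T γ x₀).map
          (fun ω => (Preorder.frestrictLe (π := fun _ => X × U) t ω, ω (t + 1)))) := by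
        exact (integral_map (hm.prodMk (measurable_pi_apply (t + 1))).aemeasurable
          (hf.comp (measurable_fst.comp measurable_snd)).aestronglyMeasurable).symm
    _ = ∫ h, ∫ z, f z.1 ∂(stepKernel T γ t h)
          ∂((processLaw T γ x₀).map (Preorder.frestrictLe (π := fun _ => X × U) t)) := by
        have := Measure.isProbabilityMeasure_map (μ := processLaw T γ x₀) hm.aemeasurable
        rw [map_processLaw_step, Measure.integral_compProd hint]
    _ = ∫ h, ∫ x, f x ∂(T (h ⟨t, Finset.mem_Iic.2 le_rfl⟩))
          ∂((processLaw T γ x₀).map (Preorder.frestrictLe (π := fun _ => X × U) t)) := by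
        congr 1; ext h
        rw [← map_fst_stepKernel T γ t h, integral_map (by fun_prop) (by fun_prop)]
    _ = _ := by
        rw [integral_map (by fun_prop)]
        · rfl
        · have : StronglyMeasurable fun p : X × U => ∫ x, f x ∂(T p) :=
            hf.stronglyMeasurable.integral_kernel
          exact (this.comp_measurable (measurable_pi_apply _)).aestronglyMeasurable

/-- The stationary Markov policy that applies `g`. -/
def stationaryPolicy (g : X → U) (hg : Measurable g) : Policy X U where
  act _ h := g h.2
  measurable_act _ := hg.comp measurable_snd

theorem ae_stationaryPolicy [MeasurableEq U] (T : Kernel (X × U) X)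
    [IsMarkovKernel T] {g : X → U} (hg : Measurable g) (x₀ : X) (t : ℕ) :
    ∀ᵐ ω ∂(processLaw T (stationaryPolicy g hg) x₀), (ω t).2 = g (ω t).1 := by
  have hS : MeasurableSet {p : X × U | p.2 = g p.1} :=
    measurableSet_eq_fun measurable_snd (hg.comp measurable_fst)
  set γ := stationaryPolicy g hg
  cases t with
  | zero =>
    have h : ∀ᵐ p ∂((processLaw T γ x₀).map (fun ω => ω 0)), p.2 = g p.1 := by
      rw [map_processLaw_zero, ae_dirac_iff hS]; rfl
    exact ae_of_ae_map (measurable_pi_apply 0).aemeasurable h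
  | succ t =>
    have h : ∀ᵐ p ∂((processLaw T γ x₀).map
        (fun ω => (Preorder.frestrictLe (π := fun _ => X × U) t ω, ω (t + 1)))),
        p.2.2 = g p.2.1 := by
      rw [map_processLaw_step]
      refine (Measure.ae_compProd_iff (measurable_snd hS)).2 ?_
      refine ae_of_all _ fun h => ?_
      rw [stepKernel]
      refine (Kernel.ae_compProd_iff hS).2 (ae_of_all _ fun x => ?_)
      rw [Kernel.deterministic_apply]
      exact (ae_dirac_iff (measurable_prodMk_left hS)).2 rfl
    exact ae_of_ae_map (by fun_prop) h

/-! ### Bellman residuals and the performance identity -/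

/-- The Bellman residual of `V` at the state-action pair `p = (x, u)`,
`V(x) - (c(x, u) + β ∫ V dT(· | x, u))`. -/
noncomputable def bellmanResidual (T : Kernel (X × U) X) (c : X → U → ℝ) (β : ℝ) (V : X → ℝ)
    (p : X × U) : ℝ :=
  V p.1 - (c p.1 p.2 + β * ∫ x, V x ∂(T p))

variable (T : Kernel (X × U) X) [IsMarkovKernel T] {c : X → U → ℝ} {β : ℝ}

theorem summable_discounted (hβ0 : 0 ≤ β) (hβ1 : β < 1) {a : ℕ → ℝ} {K : ℝ}
    (ha : ∀ t, |a t| ≤ K) : Summable fun t => β ^ t * a t := by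
  refine Summable.of_norm_bounded
    ((summable_geometric_of_lt_one hβ0 hβ1).mul_right K) fun t => ?_
  rw [Real.norm_eq_abs, abs_mul, abs_of_nonneg (pow_nonneg hβ0 t)]
  exact mul_le_mul_of_nonneg_left (ha t) (pow_nonneg hβ0 t)

theorem abs_integral_le_of_bounded {Ω : Type*} [MeasurableSpace Ω] (μ : Measure Ω)
    [IsProbabilityMeasure μ] {f : Ω → ℝ} {K : ℝ} (hf : ∀ x, |f x| ≤ K) : |∫ x, f x ∂μ| ≤ K := by
  simpa using norm_integral_le_of_norm_le_const (μ := μ) (f := f) (C := K)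
    (ae_of_all _ fun x => hf x)

theorem hasSum_discountedCost (hcm : Measurable (Function.uncurry c)) {K : ℝ}
    (hc : ∀ x u, |c x u| ≤ K) (hβ0 : 0 ≤ β) (hβ1 : β < 1) (x₀ : X) (γ : Policy X U) :
    HasSum (fun t => β ^ t * ∫ ω, c (ω t).1 (ω t).2 ∂(processLaw T γ x₀))
      (discountedCost T c β x₀ γ) := by
  have hm : ∀ t : ℕ, Measurable fun ω : ℕ → X × U => c (ω t).1 (ω t).2 := fun t =>
    hcm.comp (measurable_pi_apply t)
  have hi : ∀ t : ℕ, Integrable (fun ω : ℕ → X × U => β ^ t * c (ω t).1 (ω t).2)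
      (processLaw T γ x₀) := fun t =>
    (Integrable.of_bound (hm t).aestronglyMeasurable K (ae_of_all _ fun ω => hc _ _)).const_mul _
  have hs : Summable fun t : ℕ =>
      ∫ ω, ‖β ^ t * c (ω t).1 (ω t).2‖ ∂(processLaw T γ x₀) := by
    simp only [norm_mul, norm_pow, Real.norm_eq_abs, integral_const_mul, abs_of_nonneg hβ0]
    exact summable_discounted hβ0 hβ1 fun t =>
      abs_integral_le_of_bounded _ fun ω => by simpa using hc _ _
  simpa only [integral_const_mul, discountedCost] using
    hasSum_integral_of_summable_integral_norm hi hs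

theorem abs_discountedCost_le {K : ℝ}
    (hc : ∀ x u, |c x u| ≤ K) (hβ0 : 0 ≤ β) (hβ1 : β < 1) (x₀ : X) (γ : Policy X U) :
    |discountedCost T c β x₀ γ| ≤ K / (1 - β) := by
  refine abs_integral_le_of_bounded _ fun ω => ?_
  have hg := (hasSum_geometric_of_lt_one hβ0 hβ1).mul_right K
  rw [inv_mul_eq_div] at hg
  refine tsum_of_norm_bounded (f := fun t => β ^ t * c (ω t).1 (ω t).2) hg fun t => ?_
  rw [Real.norm_eq_abs, abs_mul, abs_of_nonneg (pow_nonneg hβ0 t)]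
  exact mul_le_mul_of_nonneg_left (hc _ _) (pow_nonneg hβ0 t)

theorem bddBelow_discountedCost {K : ℝ}
    (hc : ∀ x u, |c x u| ≤ K) (hβ0 : 0 ≤ β) (hβ1 : β < 1) (x₀ : X) :
    BddBelow (Set.range (discountedCost T c β x₀)) :=
  ⟨-(K / (1 - β)), by
    rintro _ ⟨γ, rfl⟩
    exact (abs_le.1 (abs_discountedCost_le T hc hβ0 hβ1 x₀ γ)).1⟩

instance [Nonempty U] : Nonempty (Policy X U) :=
  ⟨stationaryPolicy (fun _ => Classical.arbitrary U) measurable_const⟩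

theorem abs_optimalValue_le [Nonempty U] {K : ℝ}
    (hc : ∀ x u, |c x u| ≤ K) (hβ0 : 0 ≤ β) (hβ1 : β < 1) (x₀ : X) :
    |optimalValue T c β x₀| ≤ K / (1 - β) := by
  have h := fun γ => abs_le.1 (abs_discountedCost_le T hc hβ0 hβ1 x₀ γ)
  refine abs_le.2 ⟨le_ciInf fun γ => (h γ).1, ?_⟩
  exact (ciInf_le (bddBelow_discountedCost T hc hβ0 hβ1 x₀) (Classical.arbitrary _)).trans
    (h _).2

/-- The performance identity: under any policy, `V(x₀) - J_β(x₀, γ)` is the discounted sum of the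
expected Bellman residuals of `V`. The terms `β^t E[V(X_t)]` telescope by the Markov property. -/
theorem hasSum_bellmanResidual (hcm : Measurable (Function.uncurry c)) {K : ℝ}
    (hc : ∀ x u, |c x u| ≤ K) (hβ0 : 0 ≤ β) (hβ1 : β < 1) {V : X → ℝ} (hVm : Measurable V)
    {K' : ℝ} (hV : ∀ x, |V x| ≤ K') (x₀ : X) (γ : Policy X U) :
    HasSum (fun t => β ^ t * ∫ ω, bellmanResidual T c β V (ω t) ∂(processLaw T γ x₀))
      (V x₀ - discountedCost T c β x₀ γ) := by
  set P := processLaw T γ x₀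
  set a : ℕ → ℝ := fun t => ∫ ω, V (ω t).1 ∂P
  have ha0 : a 0 = V x₀ := by
    have h : a 0 = ∫ p, V p.1 ∂(P.map fun ω => ω 0) := by
      rw [integral_map (measurable_pi_apply 0).aemeasurable
        (hVm.comp measurable_fst).aestronglyMeasurable]
    rw [h, map_processLaw_zero]
    exact integral_dirac' _ _ (hVm.comp measurable_fst).stronglyMeasurable
  have hsum : Summable fun t => β ^ t * a t :=
    summable_discounted hβ0 hβ1 fun t => abs_integral_le_of_bounded P fun ω => hV _
  have htel : HasSum (fun t => β ^ t * a t - β ^ (t + 1) * a (t + 1)) (V x₀) := by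
    have h1 := hsum.hasSum
    have h2 := (hasSum_nat_add_iff' 1).2 h1
    simpa [ha0] using h1.sub h2
  refine (htel.sub (hasSum_discountedCost T hcm hc hβ0 hβ1 x₀ γ)).congr_fun fun t => ?_
  have hi1 : Integrable (fun ω : ℕ → X × U => V (ω t).1) P :=
    Integrable.of_bound
      (hVm.comp (measurable_fst.comp (measurable_pi_apply t))).aestronglyMeasurable K'
      (ae_of_all _ fun ω => hV _)
  have hi2 : Integrable (fun ω : ℕ → X × U => c (ω t).1 (ω t).2) P :=
    Integrable.of_bound (hcm.comp (measurable_pi_apply t)).aestronglyMeasurable K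
      (ae_of_all _ fun ω => hc _ _)
  have hi3 : Integrable (fun ω : ℕ → X × U => ∫ x, V x ∂(T (ω t))) P :=
    Integrable.of_bound (hVm.stronglyMeasurable.integral_kernel.comp_measurable
      (measurable_pi_apply t)).aestronglyMeasurable K'
      (ae_of_all _ fun ω => abs_integral_le_of_bounded _ hV)
  have hstep : a (t + 1) = ∫ ω, ∫ x, V x ∂(T (ω t)) ∂P :=
    integral_processLaw_succ T γ x₀ hVm hV t
  simp only [bellmanResidual]
  rw [integral_sub hi1 (by exact hi2.add (hi3.const_mul β)), integral_add hi2 (hi3.const_mul β),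
    integral_const_mul, ← hstep]
  ring

theorem ofReal_le_of_hasSum_discounted {Ω : Type*} [MeasurableSpace Ω] {μ : Measure Ω}
    (hβ0 : 0 ≤ β) {d : ℕ → Ω → ℝ} {s : ℝ} (hs : HasSum (fun t => β ^ t * ∫ ω, d t ω ∂μ) s)
    {e : ℕ → Ω → ℝ≥0∞} (he : ∀ t, ∀ᵐ ω ∂μ, ENNReal.ofReal (d t ω) ≤ e t ω) :
    ENNReal.ofReal s ≤ ∑' t, ENNReal.ofReal (β ^ t) * ∫⁻ ω, e t ω ∂μ := by
  -- Integrability of `d t` is not needed: otherwise its integral is `0` by convention.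
  have hd : ∀ t, ENNReal.ofReal (∫ ω, d t ω ∂μ) ≤ ∫⁻ ω, e t ω ∂μ := fun t => by
    by_cases hi : Integrable (d t) μ
    · rw [integral_eq_lintegral_pos_part_sub_lintegral_neg_part hi]
      refine (ENNReal.ofReal_le_ofReal (sub_le_self _ ENNReal.toReal_nonneg)).trans ?_
      exact ENNReal.ofReal_toReal_le.trans (lintegral_mono_ae (he t))
    · simp [integral_undef hi]
  refine le_of_tendsto (ENNReal.tendsto_ofReal hs) (Filter.Eventually.of_forall fun F => ?_)
  calc ENNReal.ofReal (∑ t ∈ F, β ^ t * ∫ ω, d t ω ∂μ)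
      ≤ ∑ t ∈ F, ENNReal.ofReal (β ^ t * ∫ ω, d t ω ∂μ) :=
        Finset.le_sum_of_subadditive _ ENNReal.ofReal_zero.le (fun _ _ => ENNReal.ofReal_add_le) F _
    _ ≤ ∑ t ∈ F, ENNReal.ofReal (β ^ t) * ∫⁻ ω, e t ω ∂μ := by
        refine Finset.sum_le_sum fun t _ => ?_
        rw [ENNReal.ofReal_mul (pow_nonneg hβ0 t)]
        gcongr
        exact hd t
    _ ≤ _ := ENNReal.sum_le_tsum F

/-! ### The two halves of the verification argument -/

/-- If the positive part of the Bellman residual of `V` is at most `e` at every state, then `V`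
exceeds the optimal value by at most the discounted worst expected `e`. -/
theorem ofReal_sub_optimalValue_le [Nonempty U] (hcm : Measurable (Function.uncurry c)) {K : ℝ}
    (hc : ∀ x u, |c x u| ≤ K) (hβ0 : 0 ≤ β) (hβ1 : β < 1) {V : X → ℝ} (hVm : Measurable V)
    {K' : ℝ} (hV : ∀ x, |V x| ≤ K') {e : X → ℝ≥0∞}
    (he : ∀ p, ENNReal.ofReal (bellmanResidual T c β V p) ≤ e p.1) (x₀ : X) :
    ENNReal.ofReal (V x₀ - optimalValue T c β x₀) ≤
      ∑' t, ENNReal.ofReal (β ^ t) *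
        ⨆ γ : Policy X U, ∫⁻ ω, e (ω t).1 ∂(processLaw T γ x₀) := by
  set R := ∑' t, ENNReal.ofReal (β ^ t) *
    ⨆ γ : Policy X U, ∫⁻ ω, e (ω t).1 ∂(processLaw T γ x₀) with hR
  -- The bound by `R` holds for every policy, and passes to the infimum once `R` is finite.
  by_cases hRtop : R = ∞
  · simp [hRtop]
  have h : ∀ γ, V x₀ - R.toReal ≤ discountedCost T c β x₀ γ := fun γ => by
    have hle := ofReal_le_of_hasSum_discounted hβ0
      (hasSum_bellmanResidual T hcm hc hβ0 hβ1 hVm hV x₀ γ)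
      (e := fun t ω => e (ω t).1) fun t => ae_of_all _ fun ω => he (ω t)
    have hle' : ENNReal.ofReal (V x₀ - discountedCost T c β x₀ γ) ≤ R := by
      refine hle.trans ?_
      rw [hR]
      gcongr with t
      exact le_iSup (fun γ : Policy X U => ∫⁻ ω, e (ω t).1 ∂(processLaw T γ x₀)) γ
    linarith [(ENNReal.ofReal_le_iff_le_toReal hRtop).1 hle']
  rw [ENNReal.ofReal_le_iff_le_toReal hRtop]
  linarith [show V x₀ - R.toReal ≤ optimalValue T c β x₀ from le_ciInf h]

/-- If the negative part of the Bellman residual of `V` is at most `e` along the actions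
prescribed by `g`, then the stationary policy `g` shows that the optimal value exceeds `V` by at
most the discounted worst expected `e`. No bound at the other actions is needed, since almost
surely the stationary policy never uses them. -/
theorem ofReal_optimalValue_sub_le [MeasurableEq U] (hcm : Measurable (Function.uncurry c)) {K : ℝ}
    (hc : ∀ x u, |c x u| ≤ K) (hβ0 : 0 ≤ β) (hβ1 : β < 1) {V : X → ℝ} (hVm : Measurable V)
    {K' : ℝ} (hV : ∀ x, |V x| ≤ K') {e : X → ℝ≥0∞} {g : X → U} (hg : Measurable g)
    (he : ∀ x, ENNReal.ofReal (-bellmanResidual T c β V (x, g x)) ≤ e x) (x₀ : X) :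
    ENNReal.ofReal (optimalValue T c β x₀ - V x₀) ≤
      ∑' t, ENNReal.ofReal (β ^ t) *
        ⨆ γ : Policy X U, ∫⁻ ω, e (ω t).1 ∂(processLaw T γ x₀) := by
  set γ := stationaryPolicy g hg
  have h := (hasSum_bellmanResidual T hcm hc hβ0 hβ1 hVm hV x₀ γ).neg
  simp only [neg_sub, ← mul_neg, ← integral_neg] at h
  have hle := ofReal_le_of_hasSum_discounted hβ0 h (e := fun t ω => e (ω t).1) fun t => by
    filter_upwards [ae_stationaryPolicy T hg x₀ t] with ω hω
    have : ω t = ((ω t).1, g (ω t).1) := Prod.ext rfl hω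
    rw [this]
    exact he _
  refine (ENNReal.ofReal_le_ofReal (sub_le_sub_right
    (ciInf_le (bddBelow_discountedCost T hc hβ0 hβ1 x₀) γ) _)).trans (hle.trans ?_)
  gcongr with t
  exact le_iSup (fun γ : Policy X U => ∫⁻ ω, e (ω t).1 ∂(processLaw T γ x₀)) γ

end ProcessLaw

/-! ### The Bellman equation of a finite-state model -/

section FiniteState

variable {S U : Type*} [Finite S] [MeasurableSpace S] [MeasurableSingletonClass S]
  [Finite U] [Nonempty U] [MeasurableSpace U]
  (T : Kernel (S × U) S) [IsMarkovKernel T] (c : S → U → ℝ) {β : ℝ}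

/-- The Bellman operator contracts the supremum distance by the factor `β`. -/
theorem exists_bellman_fixedPoint (hβ0 : 0 ≤ β) (hβ1 : β < 1) :
    ∃ V : S → ℝ, ∀ s, V s = ⨅ u, (c s u + β * ∫ z, V z ∂(T (s, u))) := by
  have := Fintype.ofFinite S
  set F : (S → ℝ) → S → ℝ := fun V s => ⨅ u, (c s u + β * ∫ z, V z ∂(T (s, u)))
  have hle : ∀ (V W : S → ℝ) (s : S), F V s ≤ F W s + β * dist V W := by
    intro V W s
    rw [← sub_le_iff_le_add]
    refine le_ciInf fun u => ?_
    rw [sub_le_iff_le_add]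
    refine (ciInf_le (Set.finite_range _).bddBelow u).trans ?_
    have h : ∫ z, V z ∂(T (s, u)) ≤ ∫ z, W z ∂(T (s, u)) + dist V W := by
      have h1 : ∫ z, (W z + dist V W) ∂(T (s, u)) = ∫ z, W z ∂(T (s, u)) + dist V W := by
        rw [integral_add .of_finite .of_finite]; simp
      rw [← h1]
      refine integral_mono .of_finite .of_finite fun z => ?_
      have h2 := (le_abs_self _).trans (dist_le_pi_dist V W z)
      linarith
    nlinarith
  have hcontr : ContractingWith β.toNNReal F := by
    refine ⟨Real.toNNReal_lt_one.2 hβ1, LipschitzWith.of_dist_le_mul fun V W => ?_⟩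
    rw [Real.coe_toNNReal _ hβ0]
    refine (dist_pi_le_iff (by positivity)).2 fun s => ?_
    rw [Real.dist_eq, abs_le]
    have h1 := hle V W s
    have h2 := hle W V s
    rw [dist_comm W V] at h2
    constructor <;> linarith
  exact ⟨hcontr.fixedPoint F, fun s => congrFun hcontr.fixedPoint_isFixedPt.symm s⟩

/-- The optimal value function of a finite model solves the Bellman equation: its residual is
nonpositive, and vanishes along some stationary policy. -/
theorem bellmanResidual_optimalValue [MeasurableSingletonClass U] (hβ0 : 0 ≤ β) (hβ1 : β < 1) :
    (∀ p, bellmanResidual T c β (optimalValue T c β) p ≤ 0) ∧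
      ∃ g : S → U, ∀ s, bellmanResidual T c β (optimalValue T c β) (s, g s) = 0 := by
  obtain ⟨V, hV⟩ := exists_bellman_fixedPoint T c hβ0 hβ1
  have hcm : Measurable (Function.uncurry c) := measurable_of_finite _
  obtain ⟨K, hK⟩ := (Set.finite_range fun p : S × U => |c p.1 p.2|).bddAbove
  obtain ⟨K', hK'⟩ := (Set.finite_range fun s => |V s|).bddAbove
  have hc : ∀ s u, |c s u| ≤ K := fun s u => hK ⟨(s, u), rfl⟩
  have hVb : ∀ s, |V s| ≤ K' := fun s => hK' ⟨s, rfl⟩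
  have hres : ∀ p, bellmanResidual T c β V p ≤ 0 := fun p => by
    rw [bellmanResidual, hV p.1]
    exact sub_nonpos.2 (ciInf_le (Set.finite_range _).bddBelow p.2)
  have hex : ∀ s, ∃ u, bellmanResidual T c β V (s, u) = 0 := fun s => by
    obtain ⟨u, hu⟩ := exists_eq_ciInf_of_finite
      (f := fun u => c s u + β * ∫ z, V z ∂(T (s, u)))
    exact ⟨u, by rw [bellmanResidual, hV s, ← hu]; exact sub_self _⟩
  choose g hg using hex
  have hVopt : V = optimalValue T c β := by
    funext s
    have h1 := ofReal_sub_optimalValue_le T hcm hc hβ0 hβ1 (measurable_of_finite V) hVb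
      (e := 0) (fun p => by simpa using hres p) s
    have h2 := ofReal_optimalValue_sub_le T hcm hc hβ0 hβ1 (measurable_of_finite V) hVb
      (e := 0) (measurable_of_finite g) (fun s => by simp [hg s]) s
    simp only [Pi.zero_apply, lintegral_zero, ciSup_const, mul_zero, tsum_zero, nonpos_iff_eq_zero,
      ENNReal.ofReal_eq_zero] at h1 h2
    linarith
  rw [← hVopt]
  exact ⟨hres, g, hg⟩

end FiniteState

/-! ### Total variation -/

/-- Integrals of a function bounded by `K` differ by at most `K` times the total variation
distance. The layer-cake formula writes the integral of `f + K` as the integral over `t ∈ (0, 2K]`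
of the measure of `{t ≤ f + K}`. -/
theorem abs_integral_sub_integral_le_tvDist {X : Type*} [MeasurableSpace X] (μ ν : Measure X)
    [IsProbabilityMeasure μ] [IsProbabilityMeasure ν] {f : X → ℝ} (hf : Measurable f) {K : ℝ}
    (hK : ∀ x, |f x| ≤ K) : |∫ x, f x ∂μ - ∫ x, f x ∂ν| ≤ K * tvDist μ ν := by
  have hK0 : 0 ≤ K := by
    obtain ⟨x⟩ := nonempty_of_isProbabilityMeasure μ
    exact (abs_nonneg _).trans (hK x)
  have hlayer : ∀ (ρ : Measure X) [IsProbabilityMeasure ρ],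
      ∫ x, f x ∂ρ + K = ∫ t in Set.Ioc 0 (2 * K), ρ.real {x | t ≤ f x + K} := by
    intro ρ _
    have hi : Integrable f ρ := .of_bound hf.aestronglyMeasurable K (ae_of_all _ hK)
    have hadd : ∫ x, (f x + K) ∂ρ = ∫ x, f x ∂ρ + K := by
      rw [integral_add hi (integrable_const K)]; simp
    rw [← hadd]
    refine Integrable.integral_eq_integral_Ioc_meas_le (hi.add (integrable_const K))
      (ae_of_all _ fun x => ?_) (ae_of_all _ fun x => ?_)
    · have := (abs_le.1 (hK x)).1
      simp only [Pi.zero_apply]; linarith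
    · have := (abs_le.1 (hK x)).2
      linarith
  have hint : ∀ (ρ : Measure X) [IsProbabilityMeasure ρ],
      IntegrableOn (fun t => ρ.real {x | t ≤ f x + K}) (Set.Ioc 0 (2 * K)) := by
    intro ρ _
    have ha : Antitone fun t => ρ.real {x | t ≤ f x + K} := fun s t hst =>
      measureReal_mono fun x (hx : t ≤ f x + K) => hst.trans hx
    exact ((ha.antitoneOn _).integrableOn_isCompact isCompact_Icc).mono_set Set.Ioc_subset_Icc_self
  have hbdd : BddAbove (Set.range fun B : {B : Set X // MeasurableSet B} =>
      |μ.real B - ν.real B|) := by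
    refine ⟨1, ?_⟩
    rintro _ ⟨B, rfl⟩
    have h1 : μ.real B ≤ 1 := measureReal_le_one
    have h2 : ν.real B ≤ 1 := measureReal_le_one
    have h3 : 0 ≤ μ.real B := measureReal_nonneg
    have h4 : 0 ≤ ν.real B := measureReal_nonneg
    exact abs_le.2 ⟨by linarith, by linarith⟩
  have hbound : ∀ t ∈ Set.Ioc 0 (2 * K),
      ‖μ.real {x | t ≤ f x + K} - ν.real {x | t ≤ f x + K}‖ ≤ tvDist μ ν / 2 := fun t _ => by
    rw [tvDist, mul_div_cancel_left₀ _ two_ne_zero]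
    exact le_ciSup hbdd ⟨_, measurableSet_le measurable_const (hf.add_const K)⟩
  have h := norm_setIntegral_le_of_norm_le_const (μ := volume) measure_Ioc_lt_top hbound
  rw [integral_sub (hint μ) (hint ν), ← hlayer μ, ← hlayer ν, Real.norm_eq_abs,
    Real.volume_real_Ioc_of_le (by linarith)] at h
  calc _ = |∫ x, f x ∂μ + K - (∫ x, f x ∂ν + K)| := by congr 1; ring
    _ ≤ _ := h.trans_eq (by ring)

/-! ### The quantized model -/

namespace Quantization

variable {X U : Type*}

theorem measurable_q [MeasurableSpace X] (Q : Quantization X) : Measurable Q.q :=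
  measurable_to_countable' Q.measurableSet_bin

section

variable [MeasurableSpace X] [MeasurableSingletonClass X] [MeasurableSpace U]
  (Q : Quantization X) (T : Kernel (X × U) X) [IsMarkovKernel T]

/-- One step of the finite model averages one step of the original model over the bin. -/
theorem integral_finiteKernel [Countable U] [MeasurableSingletonClass U] (V : Q.Y → ℝ) (y : Q.Y)
    (u : U) :
    ∫ z, V z ∂(Q.finiteKernel T (y, u)) =
      ∫ x, ∫ x', V (Q.q x') ∂(T (x, u)) ∂(Q.normWeight y) := by
  have hm : ∀ z, Measurable fun x => T (x, u) (Q.bin z) := fun z =>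
    (Kernel.measurable_coe T (Q.measurableSet_bin z)).comp measurable_prodMk_right
  have hreal : ∀ z, (Q.finiteKernel T (y, u)).real {z} =
      ∫ x, (T (x, u)).real (Q.bin z) ∂(Q.normWeight y) := fun z => by
    have h : Q.finiteKernel T (y, u) {z} = Q.transProb T y u z := by
      change (∑ z' : Q.Y, Q.transProb T y u z' • Measure.dirac z') {z} = _
      rw [Measure.finsetSum_apply, Finset.sum_eq_single z (fun z' _ hz => by simp [hz])
        (fun h => absurd (Finset.mem_univ z) h)]
      simp
    simp only [measureReal_def]
    rw [h, integral_toReal (hm z).aemeasurable (ae_of_all _ fun x => measure_lt_top _ _)]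
    rfl
  have hstep : ∀ x, ∫ x', V (Q.q x') ∂(T (x, u)) = ∑ z, (T (x, u)).real (Q.bin z) * V z := by
    intro x
    have := Measure.isProbabilityMeasure_map (μ := T (x, u)) Q.measurable_q.aemeasurable
    rw [← integral_map Q.measurable_q.aemeasurable
      (measurable_of_finite V).aestronglyMeasurable, integral_fintype .of_finite]
    refine Finset.sum_congr rfl fun z _ => ?_
    rw [map_measureReal_apply Q.measurable_q (measurableSet_singleton z), smul_eq_mul]
    rfl
  rw [integral_fintype .of_finite]
  simp only [hstep, hreal, smul_eq_mul]
  rw [integral_finsetSum]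
  · simp only [integral_mul_const]
  · intro z _
    refine Integrable.mul_const (.of_bound (hm z).ennreal_toReal.aestronglyMeasurable 1
      (ae_of_all _ fun x => ?_)) _
    rw [Real.norm_of_nonneg ENNReal.toReal_nonneg]
    exact measureReal_le_one

/-- The one-step value `c(x, u) + β E[V(q(X₁)) | x, u]` in the original model of a function `V`
of the bins. -/
noncomputable def oneStepValue (c : X → U → ℝ) (β : ℝ) (V : Q.Y → ℝ) (u : U) (x : X) : ℝ :=
  c x u + β * ∫ x', V (Q.q x') ∂(T (x, u))

variable {c : X → U → ℝ} {β : ℝ}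

theorem integrable_cost_and_integral_comp_q (hcm : ∀ u, Measurable fun x => c x u) {K : ℝ}
    (hc : ∀ x u, |c x u| ≤ K) {V : Q.Y → ℝ} {K' : ℝ} (hV : ∀ z, |V z| ≤ K') (u : U)
    (μ : Measure X) [IsProbabilityMeasure μ] :
    Integrable (fun x => c x u) μ ∧
      Integrable (fun x => ∫ x', V (Q.q x') ∂(T (x, u))) μ := by
  have hm : StronglyMeasurable fun p : X × U => ∫ x', V (Q.q x') ∂(T p) :=
    ((measurable_of_finite V).comp Q.measurable_q).stronglyMeasurable.integral_kernel
  exact ⟨.of_bound (hcm u).aestronglyMeasurable K (ae_of_all _ fun x => hc x u),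
    .of_bound (hm.comp_measurable measurable_prodMk_right).aestronglyMeasurable K'
      (ae_of_all _ fun x => abs_integral_le_of_bounded _ fun x' => hV _)⟩

/-- The residual of `V ∘ q` in the original model differs from the residual of `V` in the finite
model by the deviation of the one-step value from its average over the bin. -/
theorem bellmanResidual_comp_q [Countable U] [MeasurableSingletonClass U]
    (hcm : ∀ u, Measurable fun x => c x u) {K : ℝ}
    (hc : ∀ x u, |c x u| ≤ K) {V : Q.Y → ℝ} {K' : ℝ} (hV : ∀ z, |V z| ≤ K') (x : X) (u : U) :
    bellmanResidual T c β (fun x => V (Q.q x)) (x, u) =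
      bellmanResidual (Q.finiteKernel T) (Q.finiteCost c) β V (Q.q x, u) +
        ∫ x', (Q.oneStepValue T c β V u x' - Q.oneStepValue T c β V u x)
          ∂(Q.normWeight (Q.q x)) := by
  obtain ⟨h1, h2⟩ := Q.integrable_cost_and_integral_comp_q T hcm hc hV u (Q.normWeight (Q.q x))
  have h3 : Integrable (Q.oneStepValue T c β V u) (Q.normWeight (Q.q x)) :=
    h1.add (h2.const_mul β)
  rw [integral_sub h3 (integrable_const _)]
  simp only [oneStepValue, bellmanResidual, integral_const, probReal_univ, one_smul]
  rw [integral_add h1 (h2.const_mul β), integral_const_mul, integral_finiteKernel, finiteCost]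
  ring

end

section

variable [MetricSpace X] [MeasurableSpace X] [BorelSpace X] [MeasurableSpace U]
  (Q : Quantization X) (T : Kernel (X × U) X) [IsMarkovKernel T] {c : X → U → ℝ} {β : ℝ}

theorem abs_oneStepValue_sub_le (hβ0 : 0 ≤ β) {αc αT : ℝ}
    (hcLip : ∀ x x' u, |c x u - c x' u| ≤ αc * dist x x')
    (hTLip : ∀ x x' u, tvDist (T (x, u)) (T (x', u)) ≤ αT * dist x x')
    {V : Q.Y → ℝ} {K : ℝ} (hV : ∀ z, |V z| ≤ K) (u : U) (x x' : X) :
    |Q.oneStepValue T c β V u x - Q.oneStepValue T c β V u x'| ≤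
      (αc + β * αT * K) * dist x x' := by
  have hK0 : 0 ≤ K := (abs_nonneg _).trans (hV (Q.q x))
  have h1 := hcLip x x' u
  have h2 := (abs_integral_sub_integral_le_tvDist (T (x, u)) (T (x', u))
    ((measurable_of_finite V).comp Q.measurable_q) fun x => hV (Q.q x)).trans
    (mul_le_mul_of_nonneg_left (hTLip x x' u) hK0)
  simp only [Function.comp_apply] at h2
  calc |Q.oneStepValue T c β V u x - Q.oneStepValue T c β V u x'|
      = |(c x u - c x' u) +
          β * (∫ z, V (Q.q z) ∂(T (x, u)) - ∫ z, V (Q.q z) ∂(T (x', u)))| := by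
        simp only [oneStepValue]; congr 1; ring
    _ ≤ |c x u - c x' u| +
          β * |∫ z, V (Q.q z) ∂(T (x, u)) - ∫ z, V (Q.q z) ∂(T (x', u))| := by
        refine (abs_add_le _ _).trans_eq ?_
        rw [abs_mul, abs_of_nonneg hβ0]
    _ ≤ αc * dist x x' + β * (K * (αT * dist x x')) := by gcongr
    _ = _ := by ring

/-- Averaged over the bin of `x`, the deviation of the one-step value is controlled by the
loss `L(x)`. -/
theorem ofReal_abs_integral_oneStepValue_sub_le (hβ0 : 0 ≤ β) {αc αT : ℝ}
    (hcLip : ∀ x x' u, |c x u - c x' u| ≤ αc * dist x x')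
    (hTLip : ∀ x x' u, tvDist (T (x, u)) (T (x', u)) ≤ αT * dist x x')
    {V : Q.Y → ℝ} {K : ℝ} (hV : ∀ z, |V z| ≤ K) (hC : 0 ≤ αc + β * αT * K) (u : U) (x : X) :
    ENNReal.ofReal |∫ x', (Q.oneStepValue T c β V u x' - Q.oneStepValue T c β V u x)
        ∂(Q.normWeight (Q.q x))| ≤ ENNReal.ofReal (αc + β * αT * K) * Q.loss x := by
  rw [← Real.enorm_eq_ofReal_abs, loss, ← lintegral_const_mul' _ _ ENNReal.ofReal_ne_top]
  refine (enorm_integral_le_lintegral_enorm _).trans (lintegral_mono fun x' => ?_)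
  rw [Real.enorm_eq_ofReal_abs, edist_dist, ← ENNReal.ofReal_mul hC, dist_comm]
  exact ENNReal.ofReal_le_ofReal
    (Q.abs_oneStepValue_sub_le T hβ0 hcLip hTLip hV u x' x)

end

end Quantization

theorem theorem3 {X U : Type*}
    [MetricSpace X] [SecondCountableTopology X] [MeasurableSpace X] [BorelSpace X]
    [StandardBorelSpace X]
    [Finite U] [Nonempty U] [MeasurableSpace U] [MeasurableSingletonClass U]
    (T : Kernel (X × U) X) [IsMarkovKernel T] (c : X → U → ℝ)
    (β : ℝ) (hβ0 : 0 < β) (hβ1 : β < 1)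
    (hc : ∃ K : ℝ, ∀ x u, |c x u| ≤ K)
    (αc : ℝ) (hαc : 0 < αc) (hcLip : ∀ x x' u, |c x u - c x' u| ≤ αc * dist x x')
    (αT : ℝ) (hαT : 0 < αT) (hTLip : ∀ x x' u, tvDist (T (x, u)) (T (x', u)) ≤ αT * dist x x')
    (Q : Quantization X) (x₀ : X) :
    ENNReal.ofReal |Q.extendedValue T c β x₀ - optimalValue T c β x₀| ≤
      ENNReal.ofReal (αc + β * αT * costSupNorm c / (1 - β)) *
        ∑' t : ℕ, ENNReal.ofReal (β ^ t) *
          ⨆ γ : Policy X U, ∫⁻ ω, Q.loss (ω t).1 ∂(processLaw T γ x₀) := by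
  obtain ⟨K, hK⟩ := hc
  have hc : ∀ x u, |c x u| ≤ costSupNorm c := fun x u =>
    le_ciSup (f := fun p : X × U => |c p.1 p.2|) ⟨K, by rintro _ ⟨p, rfl⟩; exact hK _ _⟩ (x, u)
  have hc0 : 0 ≤ costSupNorm c := (abs_nonneg _).trans (hc x₀ (Classical.arbitrary U))
  have hcm1 : ∀ u, Measurable fun x => c x u := fun u =>
    (LipschitzWith.of_dist_le_mul (K := ⟨αc, hαc.le⟩) fun x x' =>
      hcLip x x' u).continuous.measurable
  have hcm : Measurable (Function.uncurry c) := measurable_from_prod_countable_left hcm1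
  set V : Q.Y → ℝ := optimalValue (Q.finiteKernel T) (Q.finiteCost c) β
  have hV : ∀ y, |V y| ≤ costSupNorm c / (1 - β) :=
    abs_optimalValue_le _ (fun y u => abs_integral_le_of_bounded _ fun x => hc x u) hβ0.le hβ1
  have hVm : Measurable fun x => V (Q.q x) := (measurable_of_finite V).comp Q.measurable_q
  have hβ' : 0 < 1 - β := sub_pos.2 hβ1
  have hC : 0 ≤ αc + β * αT * (costSupNorm c / (1 - β)) := by positivity
  have hdev := fun u x =>
    Q.ofReal_abs_integral_oneStepValue_sub_le T hβ0.le hcLip hTLip hV hC u x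
  have hres := fun x u => Q.bellmanResidual_comp_q T (β := β) hcm1 hc hV x u
  obtain ⟨hneg, g, hg⟩ := bellmanResidual_optimalValue (Q.finiteKernel T) (Q.finiteCost c)
    hβ0.le hβ1
  set C := αc + β * αT * (costSupNorm c / (1 - β)) with hCdef
  have hupper := ofReal_sub_optimalValue_le T hcm hc hβ0.le hβ1 hVm (fun x => hV (Q.q x))
    (e := fun x => ENNReal.ofReal C * Q.loss x) (fun p => by
      refine (ENNReal.ofReal_le_ofReal ?_).trans (hdev p.2 p.1)
      rw [hres p.1 p.2]
      linarith [hneg (Q.q p.1, p.2), le_abs_self (∫ x', (Q.oneStepValue T c β V p.2 x' -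
        Q.oneStepValue T c β V p.2 p.1) ∂(Q.normWeight (Q.q p.1)))]) x₀
  have hlower := ofReal_optimalValue_sub_le T hcm hc hβ0.le hβ1 hVm (fun x => hV (Q.q x))
    (e := fun x => ENNReal.ofReal C * Q.loss x)
    ((measurable_of_finite g).comp Q.measurable_q) (fun x => by
      refine (ENNReal.ofReal_le_ofReal ?_).trans (hdev (g (Q.q x)) x)
      rw [Function.comp_apply, hres, hg, zero_add]
      exact neg_le_abs _) x₀
  have hsum : ENNReal.ofReal C * ∑' t : ℕ, ENNReal.ofReal (β ^ t) *
      ⨆ γ : Policy X U, ∫⁻ ω, Q.loss (ω t).1 ∂(processLaw T γ x₀) =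
      ∑' t : ℕ, ENNReal.ofReal (β ^ t) *
        ⨆ γ : Policy X U, ∫⁻ ω, ENNReal.ofReal C * Q.loss (ω t).1 ∂(processLaw T γ x₀) := by
    rw [← ENNReal.tsum_mul_left]
    simp only [lintegral_const_mul' _ _ ENNReal.ofReal_ne_top, ← ENNReal.mul_iSup]
    exact tsum_congr fun t => mul_left_comm _ _ _
  rw [mul_div_assoc, ← hCdef, hsum, abs_eq_max_neg, neg_sub]
  rcases max_choice (Q.extendedValue T c β x₀ - optimalValue T c β x₀)
    (optimalValue T c β x₀ - Q.extendedValue T c β x₀) with h | h <;> rw [h]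
  · exact hupper
  · exact hlower
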